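/- **Setting.** Let $(M,d)$ be a metric space. A *configuration* is a multiset $C$ of $k$ points of $M$, and $d(X,Y)$ denotes the minimum matching distance of two configurations. Given an initial configuration $C_0$ and requests $r_1,r_2,\dots,r_T\in M$, a feasible solution is a sequence $C_1,\dots,C_T$ of configurations with $r_t\in C_t$ for all $t$; its cost is $\sum_{t=1}^T d(C_{t-1},C_t)$, and $\mathrm{OPT}(C_0;r_1,\dots,r_T)$ is the optimal cost. The *work function* is $$w_t(C)=\min_{C_1\ni r_1,\dots,C_t\ni r_t}\ \sum_{\tau=1}^t d(C_{\tau-1},C_\tau)+d(C_t,C).$$ The *work function algorithm* (WFA) selects, at time $t$, a configuration $C_t\ni r_t$ minimizing $d(C_{t-1},C_t)+w_t(C_t)$, with ties broken arbitrarily. A metric space $M$ is a *tree metric* if each of its finite subsets embeds isometrically into the vertex set of a finite tree with nonnegative edge weights (with distance equal to the weight of the connecting path). For finite $M$ this means that $M$ itself embeds in this way; the vertex sets of infinite trees with positive edge weights, the line and, more generally, real trees are tree metrics, too. **Theorem.** For $k=3$ servers, WFA is $3$-competitive on every tree metric $M$. That is, the minimizer in the definition of WFA always exists, and for every bounded $B\subseteq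 M$ there is a constant $c$ such that for all initial configurations $C_0$ of three points of $B$, all finite request sequences $r_1,\dots,r_T$ in $M$, and every way of breaking ties, the configurations $C_1,\dots,C_T$ selected by WFA satisfy $$\sum_{t=1}^T d(C_{t-1},C_t)\ \le\ 3\cdot \mathrm{OPT}(C_0;r_1,\dots,r_T)+c .$$ In particular, if $M$ is bounded (for instance finite), then $c$ depends on $M$ only. -/

import Mathlib

/-!
The `k`-server problem, its work functions, the work function algorithm, and tree metrics.
-/

noncomputable section

namespace KServer

/-- A metric space is a tree metric if each of its finite subsets sits isometrically among the
vertices of a finite tree with nonnegative edge weights `ℓ`, the distance of two vertices of the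
tree being the total weight of the unique path between them. For a finite space this says that the
space itself is a subspace of a finite weighted tree. Vertex sets of infinite weighted trees and
real trees (such as the line and multiray spaces) are tree metrics as well. -/
def IsTreeMetric (M : Type*) [MetricSpace M] : Prop :=
  ∀ s : Finset M, ∃ (n : ℕ) (G : SimpleGraph (Fin n)) (ℓ : Sym2 (Fin n) → ℝ) (φ : M → Fin n),
    G.IsTree ∧ (∀ e ∈ G.edgeSet, 0 ≤ ℓ e) ∧
      ∀ x ∈ s, ∀ y ∈ s, ∀ p : G.Walk (φ x) (φ y), p.IsPath → dist x y = (p.edges.map ℓ).sum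

/-- A configuration: a multiset of `k` points, the positions of the `k` servers. -/
abbrev Config (M : Type*) (k : ℕ) : Type _ := Sym M k

variable {M : Type*} [MetricSpace M] {k : ℕ}

/-- The value of a minimum matching between two configurations. A matching is given by listing
both configurations (with multiplicities) in such a way that entries with the same index are
matched. -/
def configDist (X Y : Config M k) : ℝ :=
  sInf {v : ℝ | ∃ x y : Fin k → M,
    Finset.univ.val.map x = (X : Multiset M) ∧ Finset.univ.val.map y = (Y : Multiset M) ∧
      v = ∑ i, dist (x i) (y i)}

/-- The sequence `C 0, …, C t` starts in `C₀` and serves the first `t` requests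
`r 0, …, r (t - 1)`; the request `r s` is served by the configuration `C (s + 1)`. -/
def IsFeasible (C₀ : Config M k) (r : ℕ → M) (t : ℕ) (C : ℕ → Config M k) : Prop :=
  C 0 = C₀ ∧ ∀ s < t, r s ∈ C (s + 1)

/-- The total movement cost of `C 0, …, C t`. -/
def cost (t : ℕ) (C : ℕ → Config M k) : ℝ :=
  ∑ s ∈ Finset.range t, configDist (C s) (C (s + 1))

/-- The optimal offline cost of serving the first `t` requests from `C₀`. -/
def optCost (C₀ : Config M k) (r : ℕ → M) (t : ℕ) : ℝ :=
  sInf {v : ℝ | ∃ C, IsFeasible C₀ r t C ∧ v = cost t C}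

/-- The work function: the optimal cost of serving the first `t` requests from `C₀` and ending
in the configuration `X`. -/
def workFunction (C₀ : Config M k) (r : ℕ → M) (t : ℕ) (X : Config M k) : ℝ :=
  sInf {v : ℝ | ∃ C, IsFeasible C₀ r t C ∧ v = cost t C + configDist (C t) X}

/-- At the request `r t`, the work function algorithm may move from `X` to `Y`: among all
configurations that contain `r t`, the configuration `Y` minimizes the distance from `X` plus
the work function that takes the requests up to and including `r t` into account. -/
def IsWFAStep (C₀ : Config M k) (r : ℕ → M) (t : ℕ) (X Y : Config M k) : Prop :=
  r t ∈ Y ∧ ∀ Z : Config M k, r t ∈ Z →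
    configDist X Y + workFunction C₀ r (t + 1) Y ≤ configDist X Z + workFunction C₀ r (t + 1) Z

/-- `C 0, …, C T` is a run of the work function algorithm, with some way of breaking ties. -/
def IsWFARun (C₀ : Config M k) (r : ℕ → M) (T : ℕ) (C : ℕ → Config M k) : Prop :=
  C 0 = C₀ ∧ ∀ t < T, IsWFAStep C₀ r t (C t) (C (t + 1))

/-- The work function algorithm for `k` servers on `M` always has a move. -/
def WFAWellDefined (M : Type*) [MetricSpace M] (k : ℕ) : Prop :=
  ∀ (C₀ : Config M k) (r : ℕ → M) (t : ℕ) (X : Config M k), ∃ Y, IsWFAStep C₀ r t X Y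

/-- The work function algorithm for `k` servers on `M` is `ρ`-competitive, however ties are broken.
The additive constant does not depend on the requests. It is uniform over all initial configurations
in a bounded set `B`, so on a bounded space (take `B = univ`), in particular on a finite one, it
depends on the space only; on an unbounded space it depends on where the servers start. -/
def WFACompetitive (M : Type*) [MetricSpace M] (k : ℕ) (ρ : ℝ) : Prop :=
  ∀ B : Set M, Bornology.IsBounded B → ∃ c : ℝ,
    ∀ C₀ : Config M k, (∀ x ∈ C₀, x ∈ B) → ∀ (r : ℕ → M) (T : ℕ) (C : ℕ → Config M k),
      IsWFARun C₀ r T C → cost T C ≤ ρ * optCost C₀ r T + c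

end KServer

end

/-!
The potential is that of a lazy adversary. If every point `x` of `M` had an antipode `x'`, a point
with `dist x' a = Δ - dist x a` for a large constant `Δ` and all `a`, it would be the minimum over
all `x`, `y`, `z` of `w {x, y, z} + w {x', y, z} + w {y', y', z} + w {z', z', z'}`, where `w` is
the current work function. Antipodes need not exist, but the value of `w` at a configuration with
antipodes can be expressed by values of `w` on `M`, up to a multiple of `Δ`: an antipode `x'` is
replaced by a point `a` of `M`, at the price `- dist x a`, and `a` is chosen optimally. In order
to avoid infima, the argument speaks about the lower bounds `L` of all terms that arise in this
way (`IsPotentialBound`).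

A step of the work function algorithm costs exactly the decrease of the current work function
along the move, so that the total cost is at most the sum of the increases of the work function at
the current configurations, less the optimal cost (`IsWFARun.cost_le`). The initial potential is
bounded below in terms of the diameter of the set of starting points (`isPotentialBound_zero`),
and the potential is always at most four times the minimum of the work function
(`IsPotentialBound.le`). It remains to see that with each request the potential grows by at least
the increase of the work function at any given configuration (`IsPotentialBound.succ`).

To see this, let `r` be the request. After the request, it is enough to consider the terms with
`z = r` (`IsLazyBound.le_potential`). In these terms, the first three values of `w` are at
configurations that contain `r`, and they do not change with the request; the last value grows by
at least the increase at the given configuration, by duality (`exists_duality`). The reduction to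
`z = r` is the place where the tree enters. As every value of the new work function is attained by
moving one of the servers to `r`, everything can be expressed by the function
`f a b = w {r, a, b}`, and there are eighteen cases according to which points are moved. In each
of them a few instances of three facts suffice: the four-point condition of tree metrics, the
triangle inequality, and the exchange property of `f`, which is itself a four-point condition and
which follows from the quasi-convexity of work functions (`quasiConvex_workFunction`). The hardest
case, `IsLazyBound.case_zyz`, is reduced in part to other terms of the potential, which are
covered by `IsLazyBound.case_xzz`. Hence the theorem holds for all metric spaces with the
four-point condition.
-/

namespace KServer

/-! ### Tree metrics satisfy the four-point condition -/

/-- The four-point condition, in the form "for each of the three pairings of four points, one of the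
other two pairings is at least as long". -/
def FourPoint (M : Type*) [MetricSpace M] : Prop :=
  ∀ a b c e : M, dist a b + dist c e ≤ dist a c + dist b e ∨
    dist a b + dist c e ≤ dist a e + dist b c

section Tree

variable {V : Type*} {G : SimpleGraph V} {ℓ : Sym2 V → ℝ} {D : V → V → ℝ}

/-- The function `D` gives the total weight of every path of `G`. -/
def IsPathWeight (G : SimpleGraph V) (ℓ : Sym2 V → ℝ) (D : V → V → ℝ) : Prop :=
  ∀ (u v : V) (p : G.Walk u v), p.IsPath → D u v = (p.edges.map ℓ).sum

lemma exists_isPathWeight (hG : G.IsTree) (ℓ : Sym2 V → ℝ) : ∃ D, IsPathWeight G ℓ D := by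
  choose P hP hPu using hG.existsUnique_path
  refine ⟨fun u v ↦ ((P u v).edges.map ℓ).sum, fun u v p hp ↦ ?_⟩
  rw [hPu u v p hp]

lemma IsPathWeight.add (hD : IsPathWeight G ℓ D) {u v m : V} {p : G.Walk u v} (hp : p.IsPath)
    (hm : m ∈ p.support) : D u v = D u m + D m v := by
  classical
  rw [hD u v p hp, hD u m _ (hp.takeUntil hm), hD m v _ (hp.dropUntil hm), ← List.sum_append,
    ← List.map_append, ← SimpleGraph.Walk.edges_append, SimpleGraph.Walk.take_spec]

lemma IsPathWeight.symm (hG : G.IsTree) (hD : IsPathWeight G ℓ D) (u v : V) : D u v = D v u := by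
  obtain ⟨p, hp, -⟩ := hG.existsUnique_path u v
  rw [hD u v p hp, hD v u _ hp.reverse, SimpleGraph.Walk.edges_reverse, List.map_reverse,
    List.sum_reverse]

lemma IsPathWeight.nonneg (hG : G.IsTree) (hℓ : ∀ e ∈ G.edgeSet, 0 ≤ ℓ e)
    (hD : IsPathWeight G ℓ D) (u v : V) : 0 ≤ D u v := by
  obtain ⟨p, hp, -⟩ := hG.existsUnique_path u v
  rw [hD u v p hp]
  refine List.sum_nonneg fun x hx ↦ ?_
  obtain ⟨e, he, rfl⟩ := List.mem_map.1 hx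
  exact hℓ e (p.edges_subset_edgeSet he)

lemma isPath_append {u v w : V} {p : G.Walk u v} {q : G.Walk v w} (hp : p.IsPath) (hq : q.IsPath)
    (h : ∀ t ∈ p.support, t ∈ q.support → t = v) : (p.append q).IsPath := by
  rw [SimpleGraph.Walk.isPath_def, SimpleGraph.Walk.support_append]
  have hq' := hq.support_nodup
  rw [← SimpleGraph.Walk.cons_tail_support, List.nodup_cons] at hq'
  refine List.nodup_append'.2 ⟨hp.support_nodup, hq'.2, fun t ht ht' ↦ ?_⟩
  exact hq'.1 (h t ht (List.mem_of_mem_tail ht') ▸ ht')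

/-- In a tree, every vertex `c` has a projection `m` to the path `p`: the first vertex of `p`
that one meets on the way from `c` to an end of `p`. -/
lemma IsPathWeight.exists_projection (hG : G.IsTree) (hD : IsPathWeight G ℓ D) {a b : V}
    {p : G.Walk a b} (hp : p.IsPath) (c : V) :
    ∃ m ∈ p.support, D c a = D c m + D m a ∧ D c b = D c m + D m b := by
  classical
  obtain ⟨q, hq, -⟩ := hG.existsUnique_path c a
  obtain ⟨m, hm, hmq, hmin⟩ := q.exists_mem_support_forall_mem_support_imp_eq p.support.toFinset
    ⟨a, by simp⟩
  have hm : m ∈ p.support := by simpa using hm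
  have hmin : ∀ t ∈ (q.takeUntil m hmq).support, t ∈ p.support → t = m := fun t ht htp ↦
    hmin t (by simpa using htp) ht
  have key : ∀ {w : V} {p' : G.Walk m w}, p'.IsPath → p'.support ⊆ p.support →
      D c w = D c m + D m w := fun hp' hsub ↦
    hD.add (isPath_append (hq.takeUntil hmq) hp' fun t ht ht' ↦ hmin t ht (hsub ht')) (by simp)
  refine ⟨m, hm, key (hp.takeUntil hm).reverse ?_, key (hp.dropUntil hm) ?_⟩
  · intro t ht
    exact p.support_takeUntil_subset_support hm (by simpa using ht)
  · exact p.support_dropUntil_subset_support hm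

lemma IsPathWeight.triangle (hG : G.IsTree) (hℓ : ∀ e ∈ G.edgeSet, 0 ≤ ℓ e)
    (hD : IsPathWeight G ℓ D) (u v w : V) : D u w ≤ D u v + D v w := by
  obtain ⟨p, hp, -⟩ := hG.existsUnique_path u w
  obtain ⟨m, hm, h₁, h₂⟩ := hD.exists_projection hG hp v
  linarith [hD.add hp hm, hD.symm hG v u, hD.symm hG m u, hD.nonneg hG hℓ v m]

/-- The projections `m` and `n` of `c` and `e` to the path from `a` to `b` are ordered along
this path, which decides which of the other two pairings is the longer one. -/
lemma IsPathWeight.fourPoint (hG : G.IsTree) (hℓ : ∀ e ∈ G.edgeSet, 0 ≤ ℓ e)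
    (hD : IsPathWeight G ℓ D) (a b c e : V) :
    D a b + D c e ≤ D a c + D b e ∨ D a b + D c e ≤ D a e + D b c := by
  classical
  obtain ⟨p, hp, -⟩ := hG.existsUnique_path a b
  obtain ⟨m, hm, hm₁, hm₂⟩ := hD.exists_projection hG hp c
  obtain ⟨n, hn, hn₁, hn₂⟩ := hD.exists_projection hG hp e
  have hs := hD.symm hG
  have := hD.triangle hG hℓ c m e
  have := hD.triangle hG hℓ m n e
  have := hD.nonneg hG hℓ m n
  have := hs a c
  have := hs b c
  have := hs a e
  have := hs b e
  have := hs m a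
  have := hs n a
  have := hs n e
  have := hs m n
  have hab := hD.add hp hm
  have hab' := hD.add hp hn
  rw [← p.take_spec hm, SimpleGraph.Walk.mem_support_append_iff] at hn
  rcases hn with hn | hn
  · left
    have := hD.add (hp.takeUntil hm) hn
    linarith
  · right
    have := hD.add (hp.dropUntil hm) hn
    linarith

end Tree

theorem IsTreeMetric.fourPoint {M : Type*} [MetricSpace M] (hM : IsTreeMetric M) :
    FourPoint M := by
  classical
  intro a b c e
  obtain ⟨n, G, ℓ, φ, hG, hℓ, h⟩ := hM {a, b, c, e}
  obtain ⟨D, hD⟩ := exists_isPathWeight hG ℓ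
  have key : ∀ x ∈ ({a, b, c, e} : Finset M), ∀ y ∈ ({a, b, c, e} : Finset M),
      dist x y = D (φ x) (φ y) := fun x hx y hy ↦ by
    obtain ⟨p, hp, -⟩ := hG.existsUnique_path (φ x) (φ y)
    rw [h x hx y hy p hp, hD _ _ p hp]
  rw [key a (by simp) b (by simp), key c (by simp) e (by simp), key a (by simp) c (by simp),
    key b (by simp) e (by simp), key a (by simp) e (by simp), key b (by simp) c (by simp)]
  exact hD.fourPoint hG hℓ _ _ _ _

/-! ### Configurations and minimum matchings -/

section Config

variable {M : Type*} {k : ℕ}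

/-- The configuration listed by `x`. -/
def conf (x : Fin k → M) : Config M k :=
  ⟨Finset.univ.val.map x, by simp⟩

lemma conf_surjective : Function.Surjective (conf : (Fin k → M) → Config M k) := by
  rintro ⟨s, hs⟩
  induction s using Quotient.inductionOn with
  | h l =>
    have hl : l.length = k := hs
    subst hl
    exact ⟨l.get, Subtype.ext (by simp [conf, Fin.univ_val_map])⟩

lemma conf_comp_perm (x : Fin k → M) (σ : Equiv.Perm (Fin k)) : conf (x ∘ σ) = conf x := by
  refine Subtype.ext ?_
  simp only [conf]
  rw [← Multiset.map_map, Multiset.map_univ_val_equiv]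

lemma exists_perm_of_conf_eq {x y : Fin k → M} (h : conf x = conf y) :
    ∃ σ : Equiv.Perm (Fin k), y = x ∘ σ := by
  classical
  have hc : ∀ a, Fintype.card {i // y i = a} = Fintype.card {i // x i = a} := fun a ↦ by
    have := congrArg (fun X : Config M k ↦ Multiset.count a (X : Multiset M)) h
    simp only [conf, Multiset.count_map, Sym.coe_mk] at this
    rw [Fintype.card_subtype, Fintype.card_subtype]
    simpa [Finset.card, Finset.filter_val, eq_comm] using this.symm
  exact ⟨Equiv.ofFiberEquiv fun a ↦ Fintype.equivOfCardEq (hc a),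
    funext fun i ↦ (Equiv.ofFiberEquiv_map _ i).symm⟩

lemma mem_conf {x : Fin k → M} {a : M} : a ∈ conf x ↔ ∃ i, x i = a := by
  rw [← Sym.mem_coe]
  simp [conf]

lemma apply_mem_conf (x : Fin k → M) (i : Fin k) : x i ∈ conf x :=
  mem_conf.2 ⟨i, rfl⟩

lemma conf_eq_iff {x : Fin k → M} {X : Config M k} :
    conf x = X ↔ Finset.univ.val.map x = (X : Multiset M) :=
  Subtype.ext_iff

variable [MetricSpace M]

lemma configDist_le (x y : Fin k → M) : configDist (conf x) (conf y) ≤ ∑ i, dist (x i) (y i) := by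
  refine csInf_le ⟨0, ?_⟩ ⟨x, y, rfl, rfl, rfl⟩
  rintro v ⟨x, y, -, -, rfl⟩
  positivity

/-- A minimum matching exists, and it can be described with any given listing of one of the two
configurations. -/
lemma exists_configDist_eq (X : Config M k) (y : Fin k → M) :
    ∃ x, conf x = X ∧ configDist X (conf y) = ∑ i, dist (x i) (y i) := by
  obtain ⟨x₀, rfl⟩ := conf_surjective X
  -- Every matching has the value of one that lists `y` as given; there are finitely many of these.
  have hfin : {v : ℝ | ∃ x y' : Fin k → M,
      Finset.univ.val.map x = (conf x₀ : Multiset M) ∧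
      Finset.univ.val.map y' = (conf y : Multiset M) ∧ v = ∑ i, dist (x i) (y' i)} =
      Set.range fun σ : Equiv.Perm (Fin k) ↦ ∑ i, dist (x₀ (σ i)) (y i) := by
    ext v
    constructor
    · rintro ⟨x, y', hx, hy, rfl⟩
      obtain ⟨σ, rfl⟩ := exists_perm_of_conf_eq (conf_eq_iff.2 hx).symm
      obtain ⟨τ, rfl⟩ := exists_perm_of_conf_eq (conf_eq_iff.2 hy).symm
      refine ⟨τ⁻¹.trans σ, ?_⟩
      dsimp only
      rw [← Equiv.sum_comp τ fun i ↦ dist (x₀ ((τ⁻¹.trans σ) i)) (y i)]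
      simp
    · rintro ⟨σ, rfl⟩
      exact ⟨x₀ ∘ σ, y, conf_eq_iff.1 (conf_comp_perm _ _), rfl, rfl⟩
  have hmem := (Set.range_nonempty fun σ : Equiv.Perm (Fin k) ↦
    ∑ i, dist (x₀ (σ i)) (y i)).csInf_mem (Set.finite_range _)
  obtain ⟨σ, hσ⟩ := hmem
  exact ⟨x₀ ∘ σ, conf_comp_perm _ _, by rw [configDist, hfin]; exact hσ.symm⟩

lemma configDist_nonneg (X Y : Config M k) : 0 ≤ configDist X Y := by
  obtain ⟨y, rfl⟩ := conf_surjective Y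
  obtain ⟨x, -, hx⟩ := exists_configDist_eq X y
  rw [hx]
  positivity

lemma configDist_comm (X Y : Config M k) : configDist X Y = configDist Y X := by
  have key : ∀ X Y : Config M k, configDist X Y ≤ configDist Y X := fun X Y ↦ by
    obtain ⟨x, rfl⟩ := conf_surjective X
    obtain ⟨y, rfl, hy⟩ := exists_configDist_eq Y x
    rw [hy]
    simpa only [dist_comm] using configDist_le x y
  exact le_antisymm (key X Y) (key Y X)

lemma configDist_self (X : Config M k) : configDist X X = 0 := by
  obtain ⟨x, rfl⟩ := conf_surjective X
  exact le_antisymm (by simpa using configDist_le x x) (configDist_nonneg _ _)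

lemma configDist_triangle (X Y Z : Config M k) :
    configDist X Z ≤ configDist X Y + configDist Y Z := by
  obtain ⟨z, rfl⟩ := conf_surjective Z
  obtain ⟨y, rfl, hy⟩ := exists_configDist_eq Y z
  obtain ⟨x, rfl, hx⟩ := exists_configDist_eq X y
  rw [hy, hx, ← Finset.sum_add_distrib]
  exact (configDist_le x z).trans (Finset.sum_le_sum fun i _ ↦ dist_triangle _ _ _)

lemma configDist_update_le (x : Fin k → M) (i : Fin k) (a : M) :
    configDist (conf x) (conf (Function.update x i a)) ≤ dist (x i) a := by
  refine (configDist_le _ _).trans_eq ?_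
  rw [Finset.sum_eq_single i] <;> simp +contextual [Function.update_of_ne]

/-- A minimum matching sends the point `a` of `Y` to some point `x i`, and the rest of it is a
matching of `Y` with the configuration in which `x i` is replaced by `a`. -/
lemma exists_configDist_update_le {Y : Config M k} {a : M} (ha : a ∈ Y) (x : Fin k → M) :
    ∃ i, configDist Y (conf (Function.update x i a)) + dist a (x i) ≤ configDist Y (conf x) := by
  obtain ⟨y, rfl, hy⟩ := exists_configDist_eq Y x
  obtain ⟨i, rfl⟩ := mem_conf.1 ha
  refine ⟨i, ?_⟩
  have := configDist_le y (Function.update x i (y i))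
  rw [hy, ← Finset.add_sum_erase _ _ (Finset.mem_univ i)]
  rw [← Finset.add_sum_erase _ _ (Finset.mem_univ i)] at this
  have hsum : ∑ j ∈ Finset.univ.erase i, dist (y j) (Function.update x i (y i) j) =
      ∑ j ∈ Finset.univ.erase i, dist (y j) (x j) :=
    Finset.sum_congr rfl fun j hj ↦ by rw [Function.update_of_ne (Finset.ne_of_mem_erase hj)]
  rw [hsum, Function.update_self, dist_self] at this
  linarith

end Config

/-! ### Work functions -/

section WorkFunction

variable {M : Type*} [MetricSpace M] {k : ℕ} {C₀ : Config M k} {r : ℕ → M} {t : ℕ}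

lemma cost_nonneg (t : ℕ) (C : ℕ → Config M k) : 0 ≤ cost t C :=
  Finset.sum_nonneg fun _ _ ↦ configDist_nonneg _ _

lemma exists_isFeasible {M : Type*} {k : ℕ} [NeZero k] (C₀ : Config M k) (r : ℕ → M) (t : ℕ) :
    ∃ C, IsFeasible C₀ r t C :=
  ⟨fun s ↦ s.casesOn C₀ fun s ↦ conf fun _ ↦ r s, rfl, fun _ _ ↦ mem_conf.2 ⟨0, rfl⟩⟩

lemma workFunction_le {C : ℕ → Config M k} (hC : IsFeasible C₀ r t C) (X : Config M k) :
    workFunction C₀ r t X ≤ cost t C + configDist (C t) X := by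
  refine csInf_le ⟨0, ?_⟩ ⟨C, hC, rfl⟩
  rintro v ⟨C, -, rfl⟩
  exact add_nonneg (cost_nonneg _ _) (configDist_nonneg _ _)

lemma le_workFunction [NeZero k] {X : Config M k} {v : ℝ}
    (h : ∀ C, IsFeasible C₀ r t C → v ≤ cost t C + configDist (C t) X) :
    v ≤ workFunction C₀ r t X := by
  obtain ⟨C, hC⟩ := exists_isFeasible C₀ r t
  refine le_csInf ⟨_, C, hC, rfl⟩ ?_
  rintro _ ⟨C, hC, rfl⟩
  exact h C hC

lemma workFunction_apply_le_cost {C : ℕ → Config M k} (hC : IsFeasible C₀ r t C) :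
    workFunction C₀ r t (C t) ≤ cost t C := by
  simpa [configDist_self] using workFunction_le hC (C t)

lemma optCost_le_workFunction [NeZero k] (C₀ : Config M k) (r : ℕ → M) (t : ℕ)
    (X : Config M k) : optCost C₀ r t ≤ workFunction C₀ r t X := by
  refine le_workFunction fun C hC ↦ ?_
  have : optCost C₀ r t ≤ cost t C := by
    refine csInf_le ⟨0, ?_⟩ ⟨C, hC, rfl⟩
    rintro v ⟨C, -, rfl⟩
    exact cost_nonneg _ _
  linarith [configDist_nonneg (C t) X]

lemma le_optCost [NeZero k] {v : ℝ} (h : ∀ C, IsFeasible C₀ r t C → v ≤ cost t C) :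
    v ≤ optCost C₀ r t := by
  obtain ⟨C, hC⟩ := exists_isFeasible C₀ r t
  refine le_csInf ⟨_, C, hC, rfl⟩ ?_
  rintro _ ⟨C, hC, rfl⟩
  exact h C hC

lemma workFunction_zero [NeZero k] (X : Config M k) :
    workFunction C₀ r 0 X = configDist C₀ X := by
  refine le_antisymm ?_ (le_workFunction fun C hC ↦ by simp [cost, hC.1])
  obtain ⟨C, hC⟩ := exists_isFeasible C₀ r 0
  simpa [cost, hC.1] using workFunction_le hC X

lemma workFunction_le_add [NeZero k] (X Y : Config M k) :
    workFunction C₀ r t X ≤ workFunction C₀ r t Y + configDist Y X := by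
  rw [← sub_le_iff_le_add]
  refine le_workFunction fun C hC ↦ ?_
  linarith [workFunction_le hC X, configDist_triangle (C t) Y X]

lemma workFunction_succ_le [NeZero k] (X : Config M k) {Y : Config M k} (hY : r t ∈ Y) :
    workFunction C₀ r (t + 1) X ≤ workFunction C₀ r t Y + configDist Y X := by
  rw [← sub_le_iff_le_add]
  refine le_workFunction fun C hC ↦ ?_
  have hC' : IsFeasible C₀ r (t + 1) fun s ↦ if s ≤ t then C s else Y := by
    refine ⟨by simpa using hC.1, fun s hs ↦ ?_⟩
    rcases Nat.lt_succ_iff_lt_or_eq.1 hs with hs | rfl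
    · simpa [Nat.succ_le_of_lt hs] using hC.2 s hs
    · simpa using hY
  have hcost : cost (t + 1) (fun s ↦ if s ≤ t then C s else Y) =
      cost t C + configDist (C t) Y := by
    rw [cost, Finset.sum_range_succ, cost]
    congr 1
    · refine Finset.sum_congr rfl fun s hs ↦ ?_
      have := Finset.mem_range.1 hs
      simp [this.le, Nat.succ_le_of_lt this]
    · simp
  have := workFunction_le hC' X
  rw [hcost] at this
  simp only [Nat.not_succ_le_self, ↓reduceIte] at this
  linarith

/-- The work function after the request `r t` is attained by a last configuration that arises from
`x` by moving a single server. -/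
lemma exists_le_workFunction_succ [NeZero k] (C₀ : Config M k) (r : ℕ → M) (t : ℕ)
    (x : Fin k → M) :
    ∃ i, workFunction C₀ r t (conf (Function.update x i (r t))) + dist (r t) (x i) ≤
      workFunction C₀ r (t + 1) (conf x) := by
  obtain ⟨i, hi⟩ := Finite.exists_min fun i ↦
    workFunction C₀ r t (conf (Function.update x i (r t))) + dist (r t) (x i)
  refine ⟨i, le_workFunction fun C hC ↦ ?_⟩
  obtain ⟨j, hj⟩ := exists_configDist_update_le (hC.2 t t.lt_succ_self) x
  have hC' : IsFeasible C₀ r t C := ⟨hC.1, fun s hs ↦ hC.2 s (hs.trans t.lt_succ_self)⟩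
  have h₁ := workFunction_le hC' (conf (Function.update x j (r t)))
  have h₂ := configDist_triangle (C t) (C (t + 1)) (conf (Function.update x j (r t)))
  rw [cost, Finset.sum_range_succ, ← cost]
  linarith [hi j]

lemma workFunction_succ_of_mem [NeZero k] {X : Config M k} (hX : r t ∈ X) :
    workFunction C₀ r (t + 1) X = workFunction C₀ r t X := by
  refine le_antisymm (by simpa [configDist_self] using workFunction_succ_le X hX) ?_
  obtain ⟨x, rfl⟩ := conf_surjective X
  obtain ⟨i, hi⟩ := exists_le_workFunction_succ C₀ r t x
  have := configDist_update_le x i (r t)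
  rw [configDist_comm, dist_comm] at this
  linarith [workFunction_le_add (C₀ := C₀) (r := r) (t := t) (conf x)
    (conf (Function.update x i (r t)))]

lemma workFunction_succ_update_le [NeZero k] (C₀ : Config M k) (r : ℕ → M) (t : ℕ)
    (x : Fin k → M) (i : Fin k) :
    workFunction C₀ r (t + 1) (conf x) ≤
      workFunction C₀ r t (conf (Function.update x i (r t))) + dist (r t) (x i) := by
  have h := configDist_update_le x i (r t)
  rw [configDist_comm, dist_comm] at h
  have hmem : r t ∈ conf (Function.update x i (r t)) := mem_conf.2 ⟨i, by simp⟩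
  exact (workFunction_succ_le (conf x) hmem).trans (by linarith)

/-- There is a move of a single server after which distance plus work function equal the
work function of the old position, the least value possible. -/
lemma exists_wfa_move [NeZero k] (C₀ : Config M k) (r : ℕ → M) (t : ℕ) (X : Config M k) :
    ∃ Y, r t ∈ Y ∧ configDist X Y + workFunction C₀ r (t + 1) Y ≤
      workFunction C₀ r (t + 1) X := by
  obtain ⟨x, rfl⟩ := conf_surjective X
  obtain ⟨i, hi⟩ := exists_le_workFunction_succ C₀ r t x
  have hmem : r t ∈ conf (Function.update x i (r t)) := mem_conf.2 ⟨i, by simp⟩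
  refine ⟨_, hmem, ?_⟩
  rw [workFunction_succ_of_mem hmem]
  linarith [configDist_update_le x i (r t), dist_comm (x i) (r t)]

theorem wfaWellDefined (M : Type*) [MetricSpace M] (k : ℕ) [NeZero k] : WFAWellDefined M k := by
  intro C₀ r t X
  obtain ⟨Y, hY, h⟩ := exists_wfa_move C₀ r t X
  refine ⟨Y, hY, fun Z _ ↦ h.trans ?_⟩
  rw [configDist_comm X Z, add_comm (configDist Z X)]
  exact workFunction_le_add X Z

lemma IsWFAStep.configDist_le [NeZero k] {X Y : Config M k} (h : IsWFAStep C₀ r t X Y) :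
    configDist X Y ≤ workFunction C₀ r (t + 1) X - workFunction C₀ r (t + 1) Y := by
  obtain ⟨Z, hZ, hZ'⟩ := exists_wfa_move C₀ r t X
  linarith [h.2 Z hZ]

/-- The cost of the work function algorithm is at most the sum of the increases of the work function
at the current configurations, less the optimal cost. -/
lemma IsWFARun.cost_le [NeZero k] {T : ℕ} {C : ℕ → Config M k} (h : IsWFARun C₀ r T C) :
    cost T C ≤ ∑ t ∈ Finset.range T,
      (workFunction C₀ r (t + 1) (C t) - workFunction C₀ r t (C t)) - optCost C₀ r T := by
  have hstep : cost T C ≤ ∑ t ∈ Finset.range T,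
      ((workFunction C₀ r (t + 1) (C t) - workFunction C₀ r t (C t)) -
        (workFunction C₀ r (t + 1) (C (t + 1)) - workFunction C₀ r t (C t))) :=
    Finset.sum_le_sum fun t ht ↦ by
      linarith [(h.2 t (Finset.mem_range.1 ht)).configDist_le]
  rw [Finset.sum_sub_distrib, Finset.sum_range_sub fun t ↦ workFunction C₀ r t (C t),
    workFunction_zero, h.1, configDist_self] at hstep
  linarith [optCost_le_workFunction C₀ r T (C T)]

end WorkFunction

/-! ### The exchange property of work functions -/

section Exchange

variable {M : Type*} {k : ℕ}

/-- Matching `x i` with `y i`, and exchanging matched points between the two configurations for an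
arbitrary set of indices, does not increase the sum of the two values of `w`. -/
def Exchangeable (w : Config M k → ℝ) (x y : Fin k → M) : Prop :=
  ∀ S : Finset (Fin k),
    w (conf (S.piecewise x y)) + w (conf (S.piecewise y x)) ≤ w (conf x) + w (conf y)

/-- Quasi-convexity of Koutsoupias and Papadimitriou: any two configurations can be matched in
such a way that exchanging matched points does not increase the sum of the values of `w`. -/
def QuasiConvex (w : Config M k → ℝ) : Prop :=
  ∀ x y : Fin k → M, ∃ σ : Equiv.Perm (Fin k), Exchangeable w x (y ∘ σ)

lemma conf_piecewise_comp_swap {x y : Fin k → M} {i j : Fin k} (hij : x i = y j)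
    {S T : Finset (Fin k)} (hi : i ∈ T ↔ j ∈ S) (hT : ∀ l ≠ i, l ∈ T ↔ l ∈ S) :
    conf (S.piecewise x (y ∘ Equiv.swap i j)) = conf (T.piecewise x y) := by
  by_cases hj : j ∈ S
  · congr 1
    ext l
    rcases eq_or_ne l i with rfl | hli
    · simp [Finset.piecewise, hi, hj, hij]
    rcases eq_or_ne l j with rfl | hlj
    · simp [Finset.piecewise, hT _ hli, hj]
    · simp [Finset.piecewise, hT _ hli, Equiv.swap_apply_of_ne_of_ne hli hlj]
  · rw [← conf_comp_perm (T.piecewise x y) (Equiv.swap i j)]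
    congr 1
    ext l
    rcases eq_or_ne l i with rfl | hli
    · rcases eq_or_ne l j with rfl | hlj
      · simp [Finset.piecewise, hi, hj]
      · simp [Finset.piecewise, hT _ hlj.symm, hj, hij]
    rcases eq_or_ne l j with rfl | hlj
    · simp [Finset.piecewise, hi, hj]
    · simp [Finset.piecewise, hT _ hli, Equiv.swap_apply_of_ne_of_ne hli hlj]

/-- A matching with the exchange property can be changed so as to match a common point of the two
configurations with itself. If `x i = y j`, an exchange along the new matching is, up to the order
of points, an exchange along the old one for the set in which `i` is put on the side of `j`. -/
lemma Exchangeable.comp_swap {w : Config M k → ℝ} {x y : Fin k → M} (h : Exchangeable w x y)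
    {i j : Fin k} (hij : x i = y j) : Exchangeable w x (y ∘ Equiv.swap i j) := by
  classical
  intro S
  let T : Finset (Fin k) := Finset.univ.filter fun l ↦ if l = i then j ∈ S else l ∈ S
  have hi : i ∈ T ↔ j ∈ S := by simp [T]
  have hT : ∀ l ≠ i, l ∈ T ↔ l ∈ S := fun l hl ↦ by simp [T, hl]
  have h' := h T
  rw [← Finset.piecewise_compl T x y] at h'
  rw [conf_comp_perm, ← Finset.piecewise_compl S x, conf_piecewise_comp_swap hij hi hT,
    conf_piecewise_comp_swap hij (T := Tᶜ) (by simp [hi]) fun l hl ↦ by simp [hT l hl]]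
  exact h'

/-- Replacing equal points of two listings of the same configuration. -/
lemma conf_update_congr {x y : Fin k → M} (h : conf x = conf y) {i j : Fin k} (hij : x i = y j)
    (a : M) : conf (Function.update x i a) = conf (Function.update y j a) := by
  obtain ⟨σ, rfl⟩ := exists_perm_of_conf_eq h.symm
  let τ := (Equiv.swap i (σ.symm j)).trans σ
  have hτ : y ∘ σ = y ∘ τ := by
    ext l
    rcases eq_or_ne l i with rfl | hi
    · simpa [τ] using hij
    rcases eq_or_ne l (σ.symm j) with rfl | hj
    · simpa [τ] using hij.symm
    · simp [τ, Equiv.swap_apply_of_ne_of_ne hi hj]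
  rw [hτ, ← conf_comp_perm (Function.update y j a) τ, Function.update_comp_equiv]
  simp [τ]

lemma QuasiConvex.exists_apply_eq {w : Config M k → ℝ} (hw : QuasiConvex w) (x : Fin k → M)
    {Y : Config M k} {i : Fin k} (hi : x i ∈ Y) :
    ∃ y, conf y = Y ∧ y i = x i ∧ Exchangeable w x y := by
  obtain ⟨y, rfl⟩ := conf_surjective Y
  obtain ⟨σ, hσ⟩ := hw x y
  rw [← conf_comp_perm y σ] at hi ⊢
  obtain ⟨j, hj⟩ := mem_conf.1 hi
  exact ⟨_, conf_comp_perm _ _, by simpa using hj, hσ.comp_swap hj.symm⟩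

variable [MetricSpace M]

lemma quasiConvex_configDist (C₀ : Config M k) : QuasiConvex (configDist C₀) := by
  intro x y
  obtain ⟨c, hc, hx⟩ := exists_configDist_eq C₀ x
  obtain ⟨c', rfl, hy⟩ := exists_configDist_eq C₀ y
  obtain ⟨σ, rfl⟩ := exists_perm_of_conf_eq hc.symm
  refine ⟨σ, fun S ↦ ?_⟩
  rw [conf_comp_perm, hx, hy, ← Equiv.sum_comp σ fun i ↦ dist (c' i) (y i),
    ← Finset.sum_add_distrib, ← conf_comp_perm c' σ]
  refine (add_le_add (configDist_le _ _) (configDist_le _ _)).trans_eq ?_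
  rw [← Finset.sum_add_distrib]
  refine Finset.sum_congr rfl fun i _ ↦ ?_
  by_cases hi : i ∈ S <;> simp [hi, add_comm]

lemma quasiConvex_workFunction [NeZero k] (C₀ : Config M k) (r : ℕ → M) (t : ℕ) :
    QuasiConvex (workFunction C₀ r t) := by
  induction t with
  | zero =>
    intro x y
    obtain ⟨σ, hσ⟩ := quasiConvex_configDist C₀ x y
    exact ⟨σ, fun S ↦ by simpa only [workFunction_zero] using hσ S⟩
  | succ t ih =>
    intro x y
    obtain ⟨i, hi⟩ := exists_le_workFunction_succ C₀ r t x
    obtain ⟨j, hj⟩ := exists_le_workFunction_succ C₀ r t y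
    -- The exchange happens before the last request; the two points that were moved to `r t` become
    -- partners of each other.
    obtain ⟨v, hv, hvi, hex⟩ := ih.exists_apply_eq (Function.update x i (r t)) (i := i)
      (Y := conf (Function.update y j (r t))) (mem_conf.2 ⟨j, by simp⟩)
    have hvi : v i = r t := by simpa using hvi
    have hy : conf (Function.update v i (y j)) = conf y := by
      rw [conf_update_congr hv (j := j) (by simpa using hvi)]
      simp
    obtain ⟨σ, hσ⟩ := exists_perm_of_conf_eq hy.symm
    refine ⟨σ, fun S ↦ ?_⟩
    rw [conf_comp_perm, ← hσ]
    have h₁ := workFunction_succ_update_le C₀ r t (S.piecewise x (Function.update v i (y j))) i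
    have h₂ := workFunction_succ_update_le C₀ r t (S.piecewise (Function.update v i (y j)) x) i
    have h₃ : Function.update (S.piecewise x (Function.update v i (y j))) i (r t) =
        S.piecewise (Function.update x i (r t)) v := by
      ext l
      rcases eq_or_ne l i with rfl | hl
      · simp [Finset.piecewise, hvi]
      · simp [Finset.piecewise, hl]
    have h₄ : Function.update (S.piecewise (Function.update v i (y j)) x) i (r t) =
        S.piecewise v (Function.update x i (r t)) := by
      ext l
      rcases eq_or_ne l i with rfl | hl
      · simp [Finset.piecewise, hvi]
      · simp [Finset.piecewise, hl]
    rw [h₃] at h₁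
    rw [h₄] at h₂
    have hS := hex S
    rw [hv] at hS
    by_cases hiS : i ∈ S
    · simp only [Finset.piecewise_eq_of_mem _ _ _ hiS, Function.update_self] at h₁ h₂
      linarith
    · simp only [Finset.piecewise_eq_of_notMem _ _ _ hiS, Function.update_self] at h₁ h₂
      linarith

end Exchange

/-! ### The two-server inequality behind the lazy adversary -/

/-- The situation of a three-server work function right after a request at `r`, seen through
`f a b = w {r, a, b}`: the function `f` is symmetric, it satisfies the exchange property
of work functions for two servers, and `L` is a lower bound of those terms of the potential whose
last parameter is `r` (up to the value of the last summand, which is expressed by `f`, too). -/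
structure IsLazyBound {M : Type*} [MetricSpace M] (f : M → M → ℝ) (r : M) (L : ℝ) : Prop where
  fourPoint : FourPoint M
  symm : ∀ a b, f a b = f b a
  exchange : ∀ a b c e, f a c + f b e ≤ f a b + f c e ∨ f a e + f b c ≤ f a b + f c e
  le : ∀ x y a b c p q, L ≤ f x y + (f a y - dist x a) + (f b c - dist y b - dist y c)
    + (f p q - dist r p - dist r q)

namespace IsLazyBound

/- In a term of the potential with parameters `x`, `y`, `z`, each of the values `w {x, y, z}`,
`w {a, y, z}`, `w {b, c, z}` of the work function is attained by moving one of the three points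
to `r`. The name of a lemma `case_uvw` records these choices: the letters `u`, `v`, `w` tell whether
the point that moves is `x` (or `a`, which replaces the antipode of `x`), `y` (or one of `b`, `c`,
which replace its antipodes; the other one is called `b`), or `z`. In the last value, one of the
three points in the place of the antipode of `z` moves, which leaves the two points `p` and `q`. -/

variable {M : Type*} [MetricSpace M] {f : M → M → ℝ} {r : M} {L : ℝ}

lemma case_xxy (h : IsLazyBound f r L) (x y z b p q : M) :
    L ≤ (f y z + dist r x) + (f y z - dist r x) + (f b z - dist y b - dist r y)
      + (f p q - dist z p - dist z q - dist r z) := by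
  have := h.le y z b p q y z
  linarith

lemma case_xyy (h : IsLazyBound f r L) (x y z a b p q : M) :
    L ≤ (f y z + dist r x) + (f a z - dist x a + dist r y) + (f b z - dist y b - dist r y)
      + (f p q - dist z p - dist z q - dist r z) := by
  have := h.le y z b p q z a
  have := h.symm a z
  have := dist_triangle_left x a r
  linarith

lemma case_xzy (h : IsLazyBound f r L) (x y z a b p q : M) :
    L ≤ (f y z + dist r x) + (f a y - dist x a + dist r z) + (f b z - dist y b - dist r y)
      + (f p q - dist z p - dist z q - dist r z) := by
  have := h.le y z b p q y a
  have := h.symm a y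
  have := dist_triangle_left x a r
  linarith

lemma case_yxy (h : IsLazyBound f r L) (x y z b p q : M) :
    L ≤ (f x z + dist r y) + (f y z - dist r x) + (f b z - dist y b - dist r y)
      + (f p q - dist z p - dist z q - dist r z) := by
  have := h.le y z b p q x z
  linarith [dist_nonneg (x := r) (y := y)]

lemma case_yyy (h : IsLazyBound f r L) (x y z a b p q : M) :
    L ≤ (f x z + dist r y) + (f a z - dist x a + dist r y) + (f b z - dist y b - dist r y)
      + (f p q - dist z p - dist z q - dist r z) := by
  have := h.le x z a p q z b
  have := h.symm b z
  have := dist_triangle_left y b r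
  linarith

lemma case_yzy (h : IsLazyBound f r L) (x y z a b p q : M) :
    L ≤ (f x z + dist r y) + (f a y - dist x a + dist r z) + (f b z - dist y b - dist r y)
      + (f p q - dist z p - dist z q - dist r z) := by
  rcases h.exchange x z a y with h₁ | h₁
  · have := h.le y z b p q x a
    have := h.symm z y
    have := dist_triangle_left x a r
    linarith
  · rcases h.fourPoint x a y b with h₂ | h₂
    · have := h.le b z a p q x y
      have := h.symm z a
      have := dist_triangle_left x y r
      have := dist_comm a b
      linarith
    · have := h.le x z b p q a y
      have := dist_triangle_left a y r
      linarith

lemma case_zxy (h : IsLazyBound f r L) (x y z b p q : M) :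
    L ≤ (f x y + dist r z) + (f y z - dist r x) + (f b z - dist y b - dist r y)
      + (f p q - dist z p - dist z q - dist r z) := by
  have := h.le y z b p q x y
  linarith

lemma case_zyy (h : IsLazyBound f r L) (x y z a b p q : M) :
    L ≤ (f x y + dist r z) + (f a z - dist x a + dist r y) + (f b z - dist y b - dist r y)
      + (f p q - dist z p - dist z q - dist r z) := by
  rcases h.exchange x y a z with h₁ | h₁
  · have := h.le y z b p q x a
    have := dist_triangle_left x a r
    linarith
  · rcases h.fourPoint x a r b with h₂ | h₂
    · have := h.le a z b p q x y
      have := h.symm y x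
      have := dist_triangle_left y b r
      have := dist_comm x r
      linarith
    · have := h.le x z b p q a y
      have := h.symm y a
      have := dist_triangle_left y b r
      have := dist_comm a r
      linarith

lemma case_zzy (h : IsLazyBound f r L) (x y z a b p q : M) :
    L ≤ (f x y + dist r z) + (f a y - dist x a + dist r z) + (f b z - dist y b - dist r y)
      + (f p q - dist z p - dist z q - dist r z) := by
  have h₀ := dist_comm y z
  have h₁ := h.le x y a z b p q
  have h₂ := h.symm z b
  have hp := dist_triangle_left z p r
  have hq := dist_triangle_left z q r
  rcases h.fourPoint r y z q with hq' | hq'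
  · rcases h.fourPoint r y z p with hp' | hp'
    · have := h.le x y a p q z b
      have := dist_triangle_left y b r
      linarith
    · linarith
  · linarith

lemma case_xxz (h : IsLazyBound f r L) (x y z b c p q : M) :
    L ≤ (f y z + dist r x) + (f y z - dist r x) + (f b c - dist y b - dist y c + dist r z)
      + (f p q - dist z p - dist z q - dist r z) := by
  have := h.symm z y
  rcases h.exchange y z p q with h₁ | h₁
  · have := h.le z y p b c z q
    have := h.symm p y
    have := dist_triangle_left z q r
    linarith
  · have := h.le z y q b c z p
    have := h.symm q y
    have := dist_triangle_left z p r
    linarith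

lemma case_xyz (h : IsLazyBound f r L) (x y z a b c p q : M) :
    L ≤ (f y z + dist r x) + (f a z - dist x a + dist r y)
      + (f b c - dist y b - dist y c + dist r z) + (f p q - dist z p - dist z q - dist r z) := by
  have := dist_triangle_left x a r
  rcases h.exchange a z b c with h₁ | h₁
  · have := h.le y z c p q a b
    have := h.symm z c
    have := dist_triangle_left y b r
    linarith
  · have := h.le y z b p q a c
    have := h.symm z b
    have := dist_triangle_left y c r
    linarith

lemma case_xzz (h : IsLazyBound f r L) (x y z a b c p q : M) :
    L ≤ (f y z + dist r x) + (f a y - dist x a + dist r z)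
      + (f b c - dist y b - dist y c + dist r z) + (f p q - dist z p - dist z q - dist r z) := by
  have := dist_triangle_left x a r
  have := h.symm z y
  rcases h.exchange a y p q with h₁ | h₁
  · have := h.le z y q b c a p
    have := h.symm y q
    have := dist_triangle_left z p r
    linarith
  · have := h.le z y p b c a q
    have := h.symm y p
    have := dist_triangle_left z q r
    linarith

lemma case_yxz (h : IsLazyBound f r L) (x y z b c p q : M) :
    L ≤ (f x z + dist r y) + (f y z - dist r x) + (f b c - dist y b - dist y c + dist r z)
      + (f p q - dist z p - dist z q - dist r z) := by
  rcases h.exchange x z b c with h₁ | h₁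
  · have := h.le y z c p q x b
    have := h.symm z c
    have := dist_triangle_left y b r
    linarith
  · have := h.le y z b p q x c
    have := h.symm z b
    have := dist_triangle_left y c r
    linarith

lemma case_yyz (h : IsLazyBound f r L) (x y z a b c p q : M) :
    L ≤ (f x z + dist r y) + (f a z - dist x a + dist r y)
      + (f b c - dist y b - dist y c + dist r z) + (f p q - dist z p - dist z q - dist r z) := by
  have := h.le x z a p q b c
  have := dist_triangle_left y b r
  have := dist_triangle_left y c r
  linarith

lemma case_zxz (h : IsLazyBound f r L) (x y z b c p q : M) :
    L ≤ (f x y + dist r z) + (f y z - dist r x) + (f b c - dist y b - dist y c + dist r z)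
      + (f p q - dist z p - dist z q - dist r z) := by
  have := h.symm z y
  rcases h.exchange x y p q with h₁ | h₁
  · have := h.le z y q b c x p
    have := h.symm y q
    have := dist_triangle_left z p r
    linarith
  · have := h.le z y p b c x q
    have := h.symm y p
    have := dist_triangle_left z q r
    linarith

lemma case_zzz (h : IsLazyBound f r L) (x y z a b c p q : M) :
    L ≤ (f x y + dist r z) + (f a y - dist x a + dist r z)
      + (f b c - dist y b - dist y c + dist r z) + (f p q - dist z p - dist z q - dist r z) := by
  have := h.le x y a b c p q
  have := dist_triangle_left z p r
  have := dist_triangle_left z q r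
  linarith

/-- The part of `case_zyz` in which `a` and `c` can change places in the pairs `x, a` and `y, c`
without a decrease of the total distance. In the same way one treats `a` and `b`. -/
lemma case_zyz_of_le (h : IsLazyBound f r L) {x y z a b c : M} (p q : M)
    (h₁ : f x a + f y z ≤ f x y + f a z) (h₂ : dist x a + dist y c ≤ dist x c + dist a y) :
    L ≤ (f x y + dist r z) + (f a z - dist x a + dist r y)
      + (f b c - dist y b - dist y c + dist r z) + (f p q - dist z p - dist z q - dist r z) := by
  have hay := dist_comm a y
  have hax := dist_comm a x
  rcases h.exchange a z b c with h₃ | h₃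
  · have := h.case_xzz y a z b x y p q
    have := h.case_xzz y c z b x y p q
    have := dist_comm c x
    have := dist_comm c y
    have := h.symm b a
    have := h.symm z c
    linarith
  · have := h.case_xzz y x y a a c b c
    have := h.le y z b p q p q
    have := dist_triangle_left z p r
    have := dist_triangle_left z q r
    have := dist_comm y x
    have := h.symm a x
    have := h.symm b z
    linarith

lemma case_zyz (h : IsLazyBound f r L) (x y z a b c p q : M) :
    L ≤ (f x y + dist r z) + (f a z - dist x a + dist r y)
      + (f b c - dist y b - dist y c + dist r z) + (f p q - dist z p - dist z q - dist r z) := by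
  rcases h.exchange x y a z with h₁ | h₁
  · rcases h.fourPoint x a y c with hc | hc
    · rcases h.fourPoint x a y b with hb | hb
      · -- Both for `b` and for `c`, the pair `x, a` can be broken up in favour of the pair `x, y`.
        -- The parameter `y` is kept or replaced by `a`; the first parameter becomes the request.
        have := h.case_xzz r a z x b c p q
        have := h.case_xzz r y z x b c p q
        have := dist_triangle_left x y r
        have := dist_self r
        linarith
      · have := h.case_zyz_of_le (b := c) p q h₁ hb
        have := h.symm b c
        linarith
    · exact h.case_zyz_of_le p q h₁ hc
  · have := h.le x z a p q b c
    have := h.le a y x b c p q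
    have := dist_triangle_left y b r
    have := dist_triangle_left y c r
    have := dist_triangle_left z p r
    have := dist_triangle_left z q r
    have := dist_comm a x
    have := h.symm a y
    linarith

/-- The sum is the one of `case_zyz` with `y` and `z` exchanged. -/
lemma case_yzz (h : IsLazyBound f r L) (x y z a b c p q : M) :
    L ≤ (f x z + dist r y) + (f a y - dist x a + dist r z)
      + (f b c - dist y b - dist y c + dist r z) + (f p q - dist z p - dist z q - dist r z) := by
  have := h.case_zyz x z y a p q b c
  linarith

/-- If every value of `W` can be reached from `f` by moving one point to `r`, then lower bounds of
the terms with last parameter `r` are lower bounds of all terms. -/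
theorem le_potential (h : IsLazyBound f r L) {W : M → M → M → ℝ}
    (hW : ∀ x y z, f y z + dist r x ≤ W x y z ∨ f x z + dist r y ≤ W x y z ∨
      f x y + dist r z ≤ W x y z) (x y z a b c p q s : M) :
    L ≤ W x y z + (W a y z - dist x a) + (W b c z - dist y b - dist y c)
      + (W p q s - dist z p - dist z q - dist z s) := by
  have h₄ : ∃ p' q', f p' q' - dist z p' - dist z q' - dist r z
      ≤ W p q s - dist z p - dist z q - dist z s := by
    rcases hW p q s with h' | h' | h'
    · exact ⟨q, s, by linarith [dist_triangle_left z p r, dist_triangle z r p, dist_comm z r]⟩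
    · exact ⟨p, s, by linarith [dist_triangle z r q, dist_comm z r]⟩
    · exact ⟨p, q, by linarith [dist_triangle z r s, dist_comm z r]⟩
  have h₃ : (∃ b', f b' z - dist y b' - dist r y ≤ W b c z - dist y b - dist y c) ∨
      f b c - dist y b - dist y c + dist r z ≤ W b c z - dist y b - dist y c := by
    rcases hW b c z with h' | h' | h'
    · exact .inl ⟨c, by linarith [dist_triangle y r b, dist_comm y r]⟩
    · exact .inl ⟨b, by linarith [dist_triangle y r c, dist_comm y r]⟩
    · exact .inr (by linarith)
  have h₂ : f y z - dist r x ≤ W a y z - dist x a ∨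
      f a z - dist x a + dist r y ≤ W a y z - dist x a ∨
      f a y - dist x a + dist r z ≤ W a y z - dist x a := by
    rcases hW a y z with h' | h' | h'
    · exact .inl (by linarith [dist_triangle x r a, dist_comm x r])
    · exact .inr (.inl (by linarith))
    · exact .inr (.inr (by linarith))
  obtain ⟨p', q', h₄⟩ := h₄
  rcases h₃ with ⟨b', h₃⟩ | h₃
  · rcases hW x y z with h₁ | h₁ | h₁ <;> rcases h₂ with h₂ | h₂ | h₂
    · linarith [h.case_xxy x y z b' p' q']
    · linarith [h.case_xyy x y z a b' p' q']
    · linarith [h.case_xzy x y z a b' p' q']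
    · linarith [h.case_yxy x y z b' p' q']
    · linarith [h.case_yyy x y z a b' p' q']
    · linarith [h.case_yzy x y z a b' p' q']
    · linarith [h.case_zxy x y z b' p' q']
    · linarith [h.case_zyy x y z a b' p' q']
    · linarith [h.case_zzy x y z a b' p' q']
  · rcases hW x y z with h₁ | h₁ | h₁ <;> rcases h₂ with h₂ | h₂ | h₂
    · linarith [h.case_xxz x y z b c p' q']
    · linarith [h.case_xyz x y z a b c p' q']
    · linarith [h.case_xzz x y z a b c p' q']
    · linarith [h.case_yxz x y z b c p' q']
    · linarith [h.case_yyz x y z a b c p' q']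
    · linarith [h.case_yzz x y z a b c p' q']
    · linarith [h.case_zxz x y z b c p' q']
    · linarith [h.case_zyz x y z a b c p' q']
    · linarith [h.case_zzz x y z a b c p' q']

end IsLazyBound

/-! ### The potential for three servers -/

section ThreeServers

variable {M : Type*}

lemma conf_three_left (a b c : M) : conf ![b, a, c] = conf ![a, b, c] := by
  refine Subtype.ext ?_
  simp [conf, Fin.univ_val_map, List.ofFn_succ, List.Perm.swap]

lemma conf_three_right (a b c : M) : conf ![a, c, b] = conf ![a, b, c] := by
  refine Subtype.ext ?_
  simp [conf, Fin.univ_val_map, List.ofFn_succ, List.Perm.swap]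

lemma pair_eq_of_conf_three_eq {r a b c e : M} (h : conf ![r, a, b] = conf ![r, c, e]) :
    a = c ∧ b = e ∨ a = e ∧ b = c := by
  have h' := congrArg Subtype.val h
  simp only [conf, Fin.univ_val_map, List.ofFn_succ, List.ofFn_zero] at h'
  have h' : [a, b].Perm [c, e] := by simpa using h'
  have ha : a = c ∨ a = e := by simpa using h'.subset (List.mem_cons_self ..)
  rcases ha with rfl | rfl
  · exact .inl ⟨rfl, by simpa using h'.cons_inv⟩
  · exact .inr ⟨rfl, by simpa using (h'.trans (.swap ..)).cons_inv⟩

/-- The exchange property for two configurations that share a point. -/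
lemma QuasiConvex.exchange_three {w : Config M 3 → ℝ} (hw : QuasiConvex w) (r a b c e : M) :
    w (conf ![r, a, c]) + w (conf ![r, b, e]) ≤ w (conf ![r, a, b]) + w (conf ![r, c, e]) ∨
      w (conf ![r, a, e]) + w (conf ![r, b, c]) ≤
        w (conf ![r, a, b]) + w (conf ![r, c, e]) := by
  obtain ⟨y, hy, hy₀, hex⟩ := hw.exists_apply_eq ![r, a, b] (Y := conf ![r, c, e]) (i := 0)
    (mem_conf.2 ⟨0, rfl⟩)
  obtain ⟨c', e', rfl⟩ : ∃ c' e', y = ![r, c', e'] :=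
    ⟨y 1, y 2, by ext l; fin_cases l <;> simp [hy₀]⟩
  have h := hex {1}
  have h₁ : ({1} : Finset (Fin 3)).piecewise ![r, a, b] ![r, c', e'] = ![r, a, e'] := by
    ext l
    fin_cases l <;> simp [Finset.piecewise]
  have h₂ : ({1} : Finset (Fin 3)).piecewise ![r, c', e'] ![r, a, b] = ![r, c', b] := by
    ext l
    fin_cases l <;> simp [Finset.piecewise]
  rw [h₁, h₂, hy, conf_three_right r b c'] at h
  rcases pair_eq_of_conf_three_eq hy with ⟨rfl, rfl⟩ | ⟨rfl, rfl⟩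
  · exact .inr h
  · exact .inl h

variable [MetricSpace M]

/-- A lower bound of the terms of the potential of the lazy adversary. The term with parameters
`x`, `y`, `z` is the sum of the values of `w` at `{x, y, z}`, `{x', y, z}`, `{y', y', z}`
and `{z', z', z'}`, up to a constant, where `x'`, `y'`, `z'` are antipodes of `x`, `y`, `z`; a point
`a` of `M` that replaces `x'` contributes the distance from `a` to `x'`, which is a constant
minus `dist x a`. -/
def IsPotentialBound (w : Config M 3 → ℝ) (L : ℝ) : Prop :=
  ∀ x y z a b c p q s, L ≤ w (conf ![x, y, z]) + (w (conf ![a, y, z]) - dist x a)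
    + (w (conf ![b, c, z]) - dist y b - dist y c)
    + (w (conf ![p, q, s]) - dist z p - dist z q - dist z s)

lemma IsPotentialBound.le {w : Config M 3 → ℝ} {L : ℝ} (h : IsPotentialBound w L)
    (X : Config M 3) : L ≤ 4 * w X := by
  obtain ⟨x, rfl⟩ := conf_surjective X
  obtain ⟨a, b, c, rfl⟩ : ∃ a b c, x = ![a, b, c] :=
    ⟨x 0, x 1, x 2, by ext l; fin_cases l <;> rfl⟩
  linarith [h a b c a a b a b c, dist_nonneg (x := a) (y := a), dist_nonneg (x := b) (y := a),
    dist_nonneg (x := b) (y := b), dist_nonneg (x := c) (y := a), dist_nonneg (x := c) (y := b),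
    dist_nonneg (x := c) (y := c)]

/-- A form of the duality of Koutsoupias and Papadimitriou. The minimum of the work function less
the distances from the request `r t` to the servers grows at least as much as the value of the work
function at `X`. Here `s` is the point of `X` that is exchanged for the server at `r t`. -/
lemma exists_duality (C₀ : Config M 3) (r : ℕ → M) (t : ℕ) (X : Config M 3) (p q : M) :
    ∃ s, workFunction C₀ r t (conf ![s, p, q]) - dist (r t) s
        + (workFunction C₀ r (t + 1) X - workFunction C₀ r t X) ≤
      workFunction C₀ r t (conf ![r t, p, q]) := by
  obtain ⟨x, rfl⟩ := conf_surjective X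
  obtain ⟨σ, hσ⟩ := quasiConvex_workFunction C₀ r t ![r t, p, q] x
  refine ⟨x (σ 0), ?_⟩
  have h := hσ {0}
  have h' := workFunction_succ_update_le C₀ r t (x ∘ σ) 0
  have h₁ : ({0} : Finset (Fin 3)).piecewise ![r t, p, q] (x ∘ σ) =
      Function.update (x ∘ σ) 0 (r t) := by
    ext l
    fin_cases l <;> simp [Finset.piecewise]
  have h₂ : ({0} : Finset (Fin 3)).piecewise (x ∘ σ) ![r t, p, q] = ![x (σ 0), p, q] := by
    ext l
    fin_cases l <;> simp [Finset.piecewise]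
  rw [h₁, h₂, conf_comp_perm] at h
  rw [conf_comp_perm] at h'
  simp only [Function.comp_apply] at h'
  linarith

lemma IsPotentialBound.succ (hM : FourPoint M) {C₀ : Config M 3} {r : ℕ → M} {t : ℕ} {L : ℝ}
    (h : IsPotentialBound (workFunction C₀ r t) L) (X : Config M 3) :
    IsPotentialBound (workFunction C₀ r (t + 1))
      (L + (workFunction C₀ r (t + 1) X - workFunction C₀ r t X)) := by
  have hf : IsLazyBound (fun a b ↦ workFunction C₀ r t (conf ![r t, a, b])) (r t)
      (L + (workFunction C₀ r (t + 1) X - workFunction C₀ r t X)) := by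
    refine ⟨hM, fun a b ↦ by rw [conf_three_right],
      (quasiConvex_workFunction C₀ r t).exchange_three (r t), fun x y a b c p q ↦ ?_⟩
    -- The server at `r t` in the last value becomes the point `s`, so that the term with parameters
    -- `x`, `y`, `r t` of the old potential can be used.
    obtain ⟨s, hs⟩ := exists_duality C₀ r t X p q
    have := h x y (r t) a b c s p q
    have hrot : ∀ a b, conf ![a, b, r t] = conf ![r t, a, b] := fun a b ↦ by
      rw [conf_three_right, conf_three_left]
    rw [hrot, hrot, hrot] at this
    linarith
  refine hf.le_potential (W := fun x y z ↦ workFunction C₀ r (t + 1) (conf ![x, y, z])) ?_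
  intro x y z
  obtain ⟨i, hi⟩ := exists_le_workFunction_succ C₀ r t ![x, y, z]
  have h₀ : Function.update ![x, y, z] 0 (r t) = ![r t, y, z] := by
    ext l
    fin_cases l <;> simp
  have h₁ : Function.update ![x, y, z] 1 (r t) = ![x, r t, z] := by
    ext l
    fin_cases l <;> simp
  have h₂ : Function.update ![x, y, z] 2 (r t) = ![x, y, r t] := by
    ext l
    fin_cases l <;> simp
  match i, hi with
  | 0, hi => exact .inl (by rwa [h₀] at hi)
  | 1, hi => exact .inr (.inl (by rwa [h₁, conf_three_left] at hi))
  | 2, hi => exact .inr (.inr (by rwa [h₂, conf_three_right, conf_three_left] at hi))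

lemma isPotentialBound_zero {B : Set M} {D : ℝ} (hB : ∀ x ∈ B, ∀ y ∈ B, dist x y ≤ D)
    {C₀ : Config M 3} (hC₀ : ∀ x ∈ C₀, x ∈ B) (r : ℕ → M) :
    IsPotentialBound (workFunction C₀ r 0) (-(12 * D)) := by
  -- All distances are compared with those from one of the initial servers.
  obtain ⟨o, ho⟩ : ∃ o, o ∈ C₀ := by
    obtain ⟨c, rfl⟩ := conf_surjective C₀
    exact ⟨c 0, apply_mem_conf c 0⟩
  have key : ∀ a b c, dist o a + dist o b + dist o c - 3 * D ≤
      workFunction C₀ r 0 (conf ![a, b, c]) := fun a b c ↦ by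
    rw [workFunction_zero]
    obtain ⟨d, rfl, hd⟩ := exists_configDist_eq C₀ ![a, b, c]
    have hoD : ∀ i, dist o (d i) ≤ D := fun i ↦
      hB _ (hC₀ _ ho) _ (hC₀ _ (apply_mem_conf d i))
    rw [hd, Fin.sum_univ_three]
    simp only [Matrix.cons_val]
    linarith [hoD 0, hoD 1, hoD 2, dist_triangle o (d 0) a, dist_triangle o (d 1) b,
      dist_triangle o (d 2) c]
  intro x y z a b c p q s
  linarith [key x y z, key a y z, key b c z, key p q s, dist_triangle_left x a o,
    dist_triangle_left y b o, dist_triangle_left y c o, dist_triangle_left z p o,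
    dist_triangle_left z q o, dist_triangle_left z s o]

theorem wfaCompetitive_three (hM : FourPoint M) : WFACompetitive M 3 3 := by
  intro B hB
  obtain ⟨D, hD⟩ := Metric.isBounded_iff.1 hB
  refine ⟨12 * D, fun C₀ hC₀ r T C hC ↦ ?_⟩
  have hbound : ∀ t, IsPotentialBound (workFunction C₀ r t) (-(12 * D) + ∑ s ∈ Finset.range t,
      (workFunction C₀ r (s + 1) (C s) - workFunction C₀ r s (C s))) := fun t ↦ by
    induction t with
    | zero =>
      simpa using isPotentialBound_zero (fun x hx y hy ↦ hD hx hy) hC₀ r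
    | succ t ih =>
      rw [Finset.sum_range_succ, ← add_assoc]
      exact ih.succ hM (C t)
  have hopt : (-(12 * D) + ∑ s ∈ Finset.range T,
      (workFunction C₀ r (s + 1) (C s) - workFunction C₀ r s (C s))) / 4 ≤ optCost C₀ r T :=
    le_optCost fun A hA ↦ by
      linarith [(hbound T).le (A T), workFunction_apply_le_cost hA]
  linarith [hC.cost_le]

end ThreeServers

end KServer

theorem mainTheorem2 {M : Type*} [MetricSpace M] (hM : KServer.IsTreeMetric M) :
    KServer.WFAWellDefined M 3 ∧ KServer.WFACompetitive M 3 3 :=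
  ⟨KServer.wfaWellDefined M 3, KServer.wfaCompetitive_three hM.fourPoint⟩
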